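/- Let $X=((X_t)_{t\ge 0},(\mathbb P_i)_{i\in S})$ be an irreducible, non-explosive continuous-time Markov chain (with right-continuous step-function paths) on a finite or countable set $S$, with transition probabilities $p_{ij}(t)$ and conservative $q$-matrix $Q=(q_{ij})$, $q_{ij}=p_{ij}'(0)$, $\sum_{j}q_{ij}=0$. Let $D\subset S$, $E=S\setminus D$, $E_\Delta=E\cup\{\Delta\}$ with $\Delta$ a cemetery point, $T=\inf\{t\ge0:X_t\in D\}$, and let $X^T_t=X_t$ for $t<T$, $X^T_t=\Delta$ for $t\ge T$. Let $P^T(t)=(p^T_{ij}(t))_{i,j\in E_\Delta}$ be the transition probabilities of $X^T$ (with $\Delta$ absorbing) and $Q^T$ its $q$-matrix: $q^T_{ij}=q_{ij}$ for $i,j\in E$, $q^T_{i\Delta}=\sum_{k\in D}q_{ik}$ for $i\in E$, $q^T_{\Delta j}=0$ for $j\in E_\Delta$. Put $\delta_\Delta=1$ and $\delta_i=0$ for $i\in E$. A distribution on $E_\Delta$ means a probability distribution giving no mass to $\Delta$. Let $\mu$ be a distribution on $E_\Delta$ such that $\mathbb P_\mu(T>t)=e^{-\alpha t}$ for all $t\ge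 0$, for some $\alpha>0$, and such that $\mu P^T(t)$ is (coordinatewise) differentiable with $\frac{d}{dt}\,\mu P^T(t)=\mu\,\frac{d}{dt}P^T(t)$ for all $t>0$, the series on the right being convergent. Suppose that $\mu$ has a quasi-limiting (Yaglom) distribution $\pi$: $\pi$ is a distribution on $E_\Delta$ and $\lim_{t\to\infty}\mathbb P_\mu(X^T_t=i\mid T>t)=\pi_i$ for all $i\in E_\Delta$. Then $$\pi=\mu+\int_0^\infty e^{\alpha t}\Bigl(\mu Q^TP^T(t)+\alpha(\mu-\delta)P^T(t)\Bigr)\,dt$$ coordinatewise, as an improper integral: the integrand is integrable on each $[0,R]$, and the integral is the limit as $R\to\infty$ of the integrals over $[0,R]$. Here $(\mu Q^TP^T(t))_j=\sum_{i}\mu_i\bigl(\sum_k q^T_{ik}p^T_{kj}(t)\bigr)$, and all the series involved converge absolutely for every $t>0$. If moreover, for some $t>0$ and $j\in E_\Delta$, the double series $\sum_{i,k}\mu_i|q^T_{ik}|p^T_{kj}(t)$ converges, then the $j$-th coordinate of the integrand at $t$ equals $e^{\alpha t}\bigl((\mu Q^T+\alpha(\mu-\delta))P^T(t)\bigr)_j$,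 with $\mu Q^T$ computed first as a row vector. In particular $\pi$ is quasi-stationary: $\mathbb P_\pi(X^T_t=i\mid T>t)=\pi_i$ for all $t\ge0$ and $i\in E_\Delta$. -/

import Mathlib

open MeasureTheory Filter Topology
open scoped NNReal ENNReal

noncomputable section

/-- A continuous-time, time-homogeneous Markov chain `((X_t)_{t ≥ 0}, (ℙ_i)_{i ∈ S})` on a countable
(discrete) state space `S`. Its paths are right-continuous and have left limits in the discrete
topology, that is, they are step functions with finitely many jumps in every bounded time interval;
in particular the chain does not explode. -/
structure CTMarkovChain (S Ω : Type*) [MeasurableSpace Ω] where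
  /-- the process -/
  X : ℝ≥0 → Ω → S
  /-- the law of the process started at a given state -/
  P : S → Measure Ω
  prob : ∀ i, IsProbabilityMeasure (P i)
  measurable_state : ∀ t j, MeasurableSet {ω | X t ω = j}
  start : ∀ i, P i {ω | X 0 ω = i} = 1
  right_cont : ∀ ω t, ∀ᶠ s in 𝓝[≥] t, X s ω = X t ω
  left_lim : ∀ ω t, ∃ j, ∀ᶠ s in 𝓝[<] t, X s ω = j
  /-- the Markov property with respect to the past `σ(X_u, u ≤ s)` -/
  markov : ∀ (i : S) (s t : ℝ≥0) (A : Set Ω),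
    MeasurableSet[⨆ u ∈ Set.Iic s, MeasurableSpace.comap (X u) ⊤] A →
    ∀ j k, P i (A ∩ {ω | X s ω = j} ∩ {ω | X (s + t) ω = k}) =
      P i (A ∩ {ω | X s ω = j}) * P j {ω | X t ω = k}

/-- `(v A)_j = ∑ᵢ vᵢ A i j`, a row vector times an infinite matrix. -/
def rowMul {ι : Type*} (v : ι → ℝ) (A : ι → ι → ℝ) (j : ι) : ℝ := ∑' i, v i * A i j

/-- `(A B) i j = ∑ₖ A i k * B k j`, the product of infinite matrices. -/
def infMatMul {ι : Type*} (A B : ι → ι → ℝ) (i j : ι) : ℝ := ∑' k, A i k * B k j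

/-- `L = ∫_0^∞ f(t) dt` as an improper integral: `f` is integrable over each bounded interval
`[0, R]`, and the integrals over `[0, R]` tend to `L` as `R → ∞`. -/
def HasImproperIntegral (f : ℝ → ℝ) (L : ℝ) : Prop :=
  (∀ R : ℝ, 0 ≤ R → IntervalIntegrable f volume 0 R) ∧
    Tendsto (fun R : ℝ => ∫ t in (0 : ℝ)..R, f t) atTop (𝓝 L)

/-- A conservative `q`-matrix: every row sums to zero. -/
def IsConservative {S : Type*} (Q : S → S → ℝ) : Prop := ∀ i, HasSum (fun j => Q i j) 0

/-- The set `E_Δ = E ∪ {Δ}`, with `E = S \ D`; the cemetery point `Δ` is `none`. -/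
abbrev EDelta {S : Type*} (D : Set S) : Type _ := Option {i : S // i ∉ D}

/-- The `q`-matrix `Q^T` on `E_Δ`: it is `q i j` on `E × E`, the killing rate
`η_i = ∑_{j ∈ D} q i j` from `i ∈ E` to `Δ`, and `0` on the row of `Δ`. -/
def killedQ {S : Type*} (Q : S → S → ℝ) (D : Set S) : EDelta D → EDelta D → ℝ
  | some i, some j => Q i j
  | some i, none => ∑' d : D, Q i d
  | none, _ => 0

/-- A probability distribution on `E_Δ` that does not charge `Δ`. -/
structure IsDistribution {S : Type*} {D : Set S} (ν : EDelta D → ℝ) : Prop where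
  nonneg : ∀ i, 0 ≤ ν i
  hasSum : HasSum ν 1
  cemetery : ν none = 0

/-- The vector `δ`: `δ_Δ = 1`, and `δ_i = 0` for `i ∈ E`. -/
def deltaVec {S : Type*} (D : Set S) : EDelta D → ℝ
  | none => 1
  | some _ => 0

namespace CTMarkovChain

variable {S Ω : Type*} [MeasurableSpace Ω] (C : CTMarkovChain S Ω)

/-- The transition probabilities `p_ij(t) = ℙ_i(X_t = j)` (used for `t ≥ 0`). -/
def trans (t : ℝ) (i j : S) : ℝ := (C.P i).real {ω | C.X t.toNNReal ω = j}

/-- `Q` is the `q`-matrix of the chain: `q_ij = p'_ij(0)` (derivative from the right). -/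
def HasQMatrix (Q : S → S → ℝ) : Prop :=
  ∀ i j, HasDerivWithinAt (fun t => C.trans t i j) (Q i j) (Set.Ici 0) 0

/-- Every state leads to every state. -/
def Irreducible : Prop := ∀ i j, ∃ t : ℝ, 0 < t ∧ 0 < C.trans t i j

/-- The first passage time `T = inf {t ≥ 0 : X_t ∈ D}`, equal to `⊤` if `D` is never visited. -/
def passage (D : Set S) : Ω → WithTop ℝ≥0 := hittingAfter C.X D 0

open Classical in
/-- The killed process: `X^T_t = X_t` for `t < T`, and `X^T_t = Δ` for `t ≥ T`. -/
def killed (D : Set S) (t : ℝ≥0) (ω : Ω) : EDelta D :=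
  if h : (t : WithTop ℝ≥0) < C.passage D ω then
    some ⟨C.X t ω, notMem_of_lt_hittingAfter h zero_le⟩
  else none

open Classical in
/-- The transition probabilities `p^T_ij(t)` of the killed process (used for `t ≥ 0`):
`ℙ_i(X^T_t = j)` for `i ∈ E`; the point `Δ` is absorbing. -/
def killedTrans (D : Set S) (t : ℝ) : EDelta D → EDelta D → ℝ
  | some i, j => (C.P i).real {ω | C.killed D t.toNNReal ω = j}
  | none, j => if j = none then 1 else 0

/-- The measure `ℙ_ν = ∑_{i ∈ E} ν_i ℙ_i` for a distribution `ν` on `E_Δ` not charging `Δ`. -/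
def law {D : Set S} (ν : EDelta D → ℝ) : Measure Ω :=
  Measure.sum fun i : {i : S // i ∉ D} => ENNReal.ofReal (ν (some i)) • C.P i

/-- The event `{T > t}`. -/
def survives (D : Set S) (t : ℝ≥0) : Set Ω := {ω | (t : WithTop ℝ≥0) < C.passage D ω}

/-- `ν_i(t) = ℙ_ν(X^T_t = i | T > t)`. -/
def condLaw {D : Set S} (ν : EDelta D → ℝ) (t : ℝ≥0) (i : EDelta D) : ℝ :=
  (ProbabilityTheory.cond (C.law ν) (C.survives D t)).real {ω | C.killed D t ω = i}

/-- Under `ℙ_ν`, the time `T` is exponentially distributed: `ℙ_ν(T > t) = e^{-α t}`, `t ≥ 0`. -/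
def IsExponential {D : Set S} (ν : EDelta D → ℝ) (α : ℝ) : Prop :=
  ∀ t : ℝ≥0, (C.law ν).real (C.survives D t) = Real.exp (-α * t)

/-- The differentiability condition: for `t > 0` the vector `ν P^T(t)` is differentiable
(coordinatewise), with derivative `ν (d/dt) P^T(t)`, a convergent series. -/
def DiffCondition {D : Set S} (ν : EDelta D → ℝ) : Prop :=
  ∀ t : ℝ, 0 < t → ∀ j,
    Summable (fun i => ν i * deriv (fun s => C.killedTrans D s i j) t) ∧
    HasDerivAt (fun s => rowMul ν (C.killedTrans D s) j)
      (∑' i, ν i * deriv (fun s => C.killedTrans D s i j) t) t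

/-- `π` is the quasi-limiting distribution (Yaglom limit) of `ν`. -/
def IsQuasiLimiting {D : Set S} (ν π : EDelta D → ℝ) : Prop :=
  IsDistribution π ∧ ∀ i, Tendsto (fun t : ℝ≥0 => C.condLaw ν t i) atTop (𝓝 (π i))

/-- `π` is a quasi-stationary distribution. -/
def IsQuasiStationary {D : Set S} (π : EDelta D → ℝ) : Prop :=
  IsDistribution π ∧ ∀ (t : ℝ≥0) (i : EDelta D), C.condLaw π t i = π i

/-- The `j`-th coordinate of `e^{α t} (μ Q^T P^T(t) + α (μ - δ) P^T(t))`, where `μ Q^T P^T(t)` is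
`μ (Q^T P^T(t))`, as in `μ (d/dt) P^T(t) = μ Q^T P^T(t)`. -/
def correction (Q : S → S → ℝ) {D : Set S} (μ : EDelta D → ℝ) (α t : ℝ) (j : EDelta D) : ℝ :=
  Real.exp (α * t) * (rowMul μ (infMatMul (killedQ Q D) (C.killedTrans D t)) j +
    rowMul (α • (μ - deltaVec D)) (C.killedTrans D t) j)

end CTMarkovChain

end

/-! Write $v(t)=\mu P^T(t)$. Because $T$ is exponential under $\mathbb P_\mu$, $e^{\alpha
t}(v_j(t)-\delta_j)$ is exactly $\mathbb P_\mu(X^T_t=j\mid T>t)-\delta_j$; for $j=\Delta$ both are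
$-1$. It equals $\mu_j-\delta_j$ at $t=0$ and tends to $\pi_j-\delta_j$. Its derivative is
$e^{\alpha t}(v_j'+\alpha(v_j-\delta_j))$, where $v'=\mu Q^TP^T$ by the differentiability condition
and the backward equation, and $\delta P^T=\delta$. Integrating over $[0,R]$ and letting
$R\to\infty$ gives the formula.

Two points need work. The backward equation for $P^T$ (`IsTransitionFunction.hasDerivAt`) needs only
lower bounds on the rates: the rows $(p^T_{ik}(h)-\delta_{ik})/h$ (Kronecker $\delta$) have sum
zero, as do those of $Q^T$, so a Scheffé argument turns asymptotic lower bounds into $\ell^1$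
convergence. The bounds (`isLowerRate_killedQ`) come from watching the chain on dyadic grids, with
no use of jump times or the strong Markov property.

The integrability of $v_j'$, which need not be continuous, follows from $v_j'\ge q^T_{jj}v_j$
(`diag_mul_rowMul_le`): it makes $e^{-q^T_{jj}t}v_j(t)$ monotone. Quasi-stationarity of $\pi$ is the
limit, again by Scheffé, of the semigroup property. -/

/-- A Scheffé-type lemma: if the rows `a x` have the same sum as `b` and are asymptotically bounded
below by `b`, then sums of `a x` against a bounded vector converge. -/
theorem tendsto_tsum_mul_of_lower_limit {ι α : Type*} {l : Filter α} {a : α → ι → ℝ} {b f : ι → ℝ}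
    {c : ℝ} (hb : HasSum b c) (ha : ∀ᶠ x in l, HasSum (a x) c)
    (hdom : ∀ᶠ x in l, ∀ k, max (b k - a x k) 0 ≤ |b k|)
    (hlim : ∀ k, Tendsto (fun x => max (b k - a x k) 0) l (𝓝 0)) (hf : ∀ k, |f k| ≤ 1) :
    Tendsto (fun x => ∑' k, a x k * f k) l (𝓝 (∑' k, b k * f k)) := by
  have hbs : Summable fun k => |b k| := hb.summable.abs
  have hmax : Tendsto (fun x => ∑' k, max (b k - a x k) 0) l (𝓝 (∑' _ : ι, (0 : ℝ))) := by
    refine tendsto_tsum_of_dominated_convergence hbs hlim ?_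
    filter_upwards [hdom] with x hx k
    rw [Real.norm_eq_abs, abs_of_nonneg (le_max_right _ _)]
    exact hx k
  rw [tsum_zero] at hmax
  have hbf : Summable fun k => b k * f k := by
    refine hbs.of_norm_bounded fun k => ?_
    rw [Real.norm_eq_abs, abs_mul]
    exact mul_le_of_le_one_right (abs_nonneg _) (hf k)
  rw [tendsto_iff_norm_sub_tendsto_zero]
  refine squeeze_zero' (Eventually.of_forall fun _ => norm_nonneg _) ?_
    (by simpa using hmax.const_mul 2)
  filter_upwards [ha, hdom] with x hax hx
  have haf : Summable fun k => a x k * f k := by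
    refine hax.summable.abs.of_norm_bounded fun k => ?_
    rw [Real.norm_eq_abs, abs_mul]
    exact mul_le_of_le_one_right (abs_nonneg _) (hf k)
  have hms : Summable fun k => max (b k - a x k) 0 :=
    Summable.of_nonneg_of_le (fun _ => le_max_right _ _) hx hbs
  -- $|a-b|=(a-b)+2(b-a)^+$, and the first term sums to zero because the masses agree.
  have habs : HasSum (fun k => (a x k - b k) + 2 * max (b k - a x k) 0)
      ((c - c) + 2 * ∑' k, max (b k - a x k) 0) := (hax.sub hb).add (hms.hasSum.mul_left 2)
  rw [sub_self, zero_add] at habs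
  rw [← habs.tsum_eq, ← haf.tsum_sub hbf]
  refine tsum_of_norm_bounded habs.summable.hasSum fun k => ?_
  rw [← sub_mul, Real.norm_eq_abs, abs_mul]
  refine (mul_le_of_le_one_right (abs_nonneg _) (hf k)).trans ?_
  rcases le_total (b k - a x k) 0 with h | h
  · rw [max_eq_right h, abs_of_nonneg (by linarith)]; linarith
  · rw [max_eq_left h, abs_of_nonpos (by linarith)]; linarith

/-! ### Transition functions and the backward equation -/

/-- An honest transition function, extended by its value at `0` to negative times. -/
structure IsTransitionFunction {ι : Type*} (p : ℝ → ι → ι → ℝ) : Prop where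
  nonneg : ∀ t i j, 0 ≤ p t i j
  hasSum_one : ∀ t i, HasSum (p t i) 1
  zero_self : ∀ i, p 0 i i = 1
  add : ∀ s t, 0 ≤ s → 0 ≤ t → ∀ i j, p (s + t) i j = ∑' k, p s i k * p t k j
  of_nonpos : ∀ t ≤ 0, p t = p 0

/-- `q` is a conservative matrix which bounds the rates of `p` at time `0` from below. -/
structure IsLowerRate {ι : Type*} (p : ℝ → ι → ι → ℝ) (q : ι → ι → ℝ) : Prop where
  hasSum_zero : ∀ i, HasSum (q i) 0
  offdiag_nonneg : ∀ i k, i ≠ k → 0 ≤ q i k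
  diag_le : ∀ i t, 0 ≤ t → 1 + q i i * t ≤ p t i i
  offdiag_le : ∀ i k, i ≠ k → ∀ ε > 0, ∀ᶠ h in 𝓝[>] (0 : ℝ), q i k - ε ≤ p h i k / h

namespace IsTransitionFunction

variable {ι : Type*} {p : ℝ → ι → ι → ℝ} {q : ι → ι → ℝ}

theorem le_one (hp : IsTransitionFunction p) (t : ℝ) (i j : ι) : p t i j ≤ 1 :=
  le_hasSum (hp.hasSum_one t i) j fun k _ => hp.nonneg t i k

theorem abs_le_one (hp : IsTransitionFunction p) (t : ℝ) (i j : ι) : |p t i j| ≤ 1 := by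
  rw [abs_of_nonneg (hp.nonneg t i j)]
  exact hp.le_one t i j

theorem summable_mul (hp : IsTransitionFunction p) {v : ι → ℝ} (hv : Summable v) (t : ℝ) (j : ι) :
    Summable fun i => v i * p t i j := by
  refine hv.abs.of_norm_bounded fun k => ?_
  rw [Real.norm_eq_abs, abs_mul]
  exact mul_le_of_le_one_right (abs_nonneg _) (hp.abs_le_one t k j)

theorem eq_max (hp : IsTransitionFunction p) (t : ℝ) : p t = p (max t 0) := by
  rcases le_total t 0 with h | h
  · rw [max_eq_right h, hp.of_nonpos t h]
  · rw [max_eq_left h]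

open Classical in
theorem hasSum_increment (hp : IsTransitionFunction p) {h t : ℝ} (hh : 0 ≤ h) (ht : 0 ≤ t)
    (i j : ι) :
    HasSum (fun k => (p h i k - if k = i then 1 else 0) * p t k j) (p (t + h) i j - p t i j) := by
  have h1 : HasSum (fun k => p h i k * p t k j) (p (t + h) i j) := by
    rw [add_comm, hp.add h t hh ht]
    exact (hp.summable_mul (hp.hasSum_one h i).summable t j).hasSum
  have h2 : HasSum (fun k => (if k = i then 1 else 0) * p t k j) (p t i j) := by
    convert hasSum_ite_eq i (p t i j) using 2 with k
    split_ifs with hk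
    · rw [hk, one_mul]
    · rw [zero_mul]
  simpa only [sub_mul] using h1.sub h2

/-- In the increment the term $k=i$ lies in $[-(1-p_{ii}(h)),0]$, and the other terms sum to
something in $[0,1-p_{ii}(h)]$. -/
theorem abs_add_sub_le (hp : IsTransitionFunction p) {h t : ℝ} (hh : 0 ≤ h) (ht : 0 ≤ t)
    (i j : ι) : |p (t + h) i j - p t i j| ≤ 1 - p h i i := by
  classical
  have h1 := hp.hasSum_increment hh ht i j
  have hd : HasSum (fun k => if k = i then p h i i else 0) (p h i i) := hasSum_ite_eq i _
  have hd' : HasSum (fun k => if k = i then (p h i i - 1) * p t i j else 0)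
    ((p h i i - 1) * p t i j) := hasSum_ite_eq i _
  have hle1 := hp.le_one h i i
  have ht0 := hp.nonneg t i j
  have ht1 := hp.le_one t i j
  have hup : p (t + h) i j - p t i j - (p h i i - 1) * p t i j ≤ 1 - p h i i := by
    refine hasSum_le (fun k => ?_) (h1.sub hd') ((hp.hasSum_one h i).sub hd)
    split_ifs with hk
    · subst hk; simp
    · simpa using mul_le_of_le_one_right (hp.nonneg h i k) (hp.le_one t k j)
  have hlo : 0 ≤ p (t + h) i j - p t i j - (p h i i - 1) * p t i j := by
    refine (h1.sub hd').nonneg fun k => ?_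
    split_ifs with hk
    · subst hk; simp
    · simpa using mul_nonneg (hp.nonneg h i k) (hp.nonneg t k j)
  rw [abs_le]
  constructor <;> nlinarith

theorem diag_nonpos (hp : IsTransitionFunction p) (hq : IsLowerRate p q) (i : ι) : q i i ≤ 0 := by
  have := hq.diag_le i 1 zero_le_one
  linarith [hp.le_one 1 i i]

theorem continuous (hp : IsTransitionFunction p) (hq : IsLowerRate p q) (i j : ι) :
    Continuous fun t => p t i j := by
  have key : ∀ s t : ℝ, 0 ≤ s → s ≤ t → |p t i j - p s i j| ≤ -q i i * (t - s) := by
    intro s t hs hst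
    have h1 := hp.abs_add_sub_le (sub_nonneg.2 hst) hs i j
    rw [add_sub_cancel] at h1
    have := hq.diag_le i (t - s) (sub_nonneg.2 hst)
    linarith
  have hL : LipschitzOnWith (-q i i).toNNReal (fun t => p t i j) (Set.Ici 0) := by
    refine LipschitzOnWith.of_dist_le_mul fun s hs t ht => ?_
    rw [Real.coe_toNNReal _ (by linarith [hp.diag_nonpos hq i]), Real.dist_eq, Real.dist_eq]
    rcases le_total s t with h | h
    · rw [abs_sub_comm, abs_sub_comm s t, abs_of_nonneg (sub_nonneg.2 h)]
      exact key s t hs h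
    · rw [abs_of_nonneg (sub_nonneg.2 h)]
      exact key t s ht h
  have : (fun t => p t i j) = (fun t => p t i j) ∘ fun t => max t 0 := by
    ext t
    simp only [Function.comp, ← hp.eq_max]
  rw [this]
  exact hL.continuousOn.comp_continuous (by fun_prop) fun t => le_max_right t 0

theorem continuous_generator (hp : IsTransitionFunction p) (hq : IsLowerRate p q) (i j : ι) :
    Continuous fun t => ∑' k, q i k * p t k j := by
  refine continuous_tsum (u := fun k => |q i k|) (fun k => (hp.continuous hq k j).const_mul _)
    (hq.hasSum_zero i).summable.abs fun k t => ?_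
  rw [Real.norm_eq_abs, abs_mul]
  exact mul_le_of_le_one_right (abs_nonneg _) (hp.abs_le_one t k j)

/-- By the semigroup property the difference quotient is a sum of $(p_{ik}(h)-\delta_{ik})/h$
against the bounded column $p_{kj}(t)$, to which the Scheffé lemma applies. -/
theorem hasDerivWithinAt_right (hp : IsTransitionFunction p) (hq : IsLowerRate p q) (i j : ι)
    {t : ℝ} (ht : 0 ≤ t) :
    HasDerivWithinAt (fun t => p t i j) (∑' k, q i k * p t k j) (Set.Ioi t) t := by
  classical
  have hpos : ∀ᶠ h in 𝓝[>] (0 : ℝ), 0 < h := eventually_mem_nhdsWithin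
  have hlow : ∀ᶠ h in 𝓝[>] (0 : ℝ), q i i ≤ (p h i i - 1) / h := by
    filter_upwards [hpos] with h hh
    rw [le_div_iff₀ hh]
    linarith [hq.diag_le i h hh.le]
  have main : Tendsto (fun h => ∑' k, (p h i k - if k = i then 1 else 0) / h * p t k j)
      (𝓝[>] 0) (𝓝 (∑' k, q i k * p t k j)) := by
    refine tendsto_tsum_mul_of_lower_limit (hq.hasSum_zero i) ?_ ?_ ?_
      (fun k => hp.abs_le_one t k j)
    · refine Eventually.of_forall fun h => ?_
      have := ((hp.hasSum_one h i).sub (hasSum_ite_eq i (1 : ℝ))).div_const h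
      simpa using this
    · filter_upwards [hpos, hlow] with h hh hl k
      by_cases hk : k = i
      · subst hk
        simp only [if_true]
        exact max_le (by linarith [abs_nonneg (q k k)]) (abs_nonneg _)
      · have h0 := hq.offdiag_nonneg i k (Ne.symm hk)
        have := div_nonneg (hp.nonneg h i k) hh.le
        simp only [hk, if_false, sub_zero, abs_of_nonneg h0]
        exact max_le (by linarith) h0
    · intro k
      by_cases hk : k = i
      · subst hk
        refine tendsto_const_nhds.congr' ?_
        filter_upwards [hlow] with h hl
        simpa using hl
      · rw [Metric.tendsto_nhds]
        intro ε hε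
        filter_upwards [hq.offdiag_le i k (Ne.symm hk) (ε / 2) (half_pos hε)] with h hh
        have hm : (0 : ℝ) ≤ max (q i k - p h i k / h) 0 := le_max_right _ _
        simp only [hk, if_false, sub_zero, Real.dist_eq, abs_of_nonneg hm]
        exact max_lt (by linarith) hε
  rw [hasDerivWithinAt_iff_tendsto_slope' (by simp)]
  have hmap : Tendsto (fun x => x - t) (𝓝[>] t) (𝓝[>] 0) := by
    refine tendsto_nhdsWithin_iff.2 ⟨?_, ?_⟩
    · have : Tendsto (fun x => x - t) (𝓝 t) (𝓝 (t - t)) := tendsto_id.sub_const t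
      rw [sub_self] at this
      exact this.mono_left nhdsWithin_le_nhds
    · filter_upwards [self_mem_nhdsWithin] with x hx
      exact Set.mem_Ioi.2 (sub_pos.2 (Set.mem_Ioi.1 hx))
  refine (main.comp hmap).congr' ?_
  filter_upwards [self_mem_nhdsWithin] with x hx
  have := ((hp.hasSum_increment (sub_nonneg.2 (le_of_lt hx)) ht i j).div_const (x - t)).tsum_eq
  rw [add_sub_cancel] at this
  rw [slope_def_field, ← this]
  exact tsum_congr fun k => by simp only; ring

/-- Kolmogorov's backward equation. -/
theorem hasDerivAt (hp : IsTransitionFunction p) (hq : IsLowerRate p q) (i j : ι)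
    {t : ℝ} (ht : 0 < t) : HasDerivAt (fun t => p t i j) (∑' k, q i k * p t k j) t := by
  have hg := hp.continuous_generator hq i j
  -- A continuous function with a continuous right derivative is the integral of it, hence
  -- differentiable from both sides.
  have hI : ∀ x : ℝ, 0 ≤ x →
      p x i j = p 0 i j + ∫ s in (0 : ℝ)..x, ∑' k, q i k * p s k j := by
    intro x hx
    rw [intervalIntegral.integral_eq_sub_of_hasDeriv_right (f := fun t => p t i j)
      (hp.continuous hq i j).continuousOn
      (fun s hs => hp.hasDerivWithinAt_right hq i j (by
        rw [min_eq_left hx] at hs; exact hs.1.le)) (hg.intervalIntegrable _ _)]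
    ring
  have hd := (hg.integral_hasStrictDerivAt 0 t).hasDerivAt.const_add (p 0 i j)
  refine hd.congr_of_eventuallyEq ?_
  filter_upwards [lt_mem_nhds ht] with x hx
  exact hI x hx.le

end IsTransitionFunction

/-! ### Avoiding `D`: dyadic grids and the Markov property up to killing -/

namespace CTMarkovChain

variable {S Ω : Type*} [MeasurableSpace Ω] (C : CTMarkovChain S Ω)

/-- The past `σ(X_u, u ≤ s)`. -/
abbrev past (s : ℝ≥0) : MeasurableSpace Ω :=
  ⨆ u ∈ Set.Iic s, MeasurableSpace.comap (C.X u) ⊤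

/-- The event that the path avoids `D` during `[s, s + t]`. -/
def stays (D : Set S) (s t : ℝ≥0) : Set Ω := {ω | ∀ u ≤ t, C.X (s + u) ω ∉ D}

/-- The event that the path avoids `D` at the times `s, s + h, …, s + n h`. -/
def gridStays (D : Set S) (s h : ℝ≥0) (n : ℕ) : Set Ω := {ω | ∀ m ≤ n, C.X (s + m * h) ω ∉ D}

theorem exists_right_const (t : ℝ≥0) (ω : Ω) :
    ∃ ε > 0, ∀ s, t ≤ s → s < t + ε → C.X s ω = C.X t ω := by
  have h := C.right_cont ω t
  rw [eventually_nhdsWithin_iff, Metric.eventually_nhds_iff] at h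
  obtain ⟨ε, hε, h⟩ := h
  refine ⟨ε.toNNReal, Real.toNNReal_pos.2 hε, fun s hs hs' => h ?_ hs⟩
  rw [NNReal.dist_eq, abs_of_nonneg (sub_nonneg.2 (NNReal.coe_le_coe.2 hs))]
  have := NNReal.coe_lt_coe.2 hs'
  rw [NNReal.coe_add, Real.coe_toNNReal _ hε.le] at this
  linarith

/-- By right-continuity a path outside `D` at time `t` stays put on some $[t,t+\varepsilon)$, which
makes the inequality strict. -/
theorem lt_passage_iff (D : Set S) (t : ℝ≥0) (ω : Ω) :
    (t : WithTop ℝ≥0) < C.passage D ω ↔ ∀ u ≤ t, C.X u ω ∉ D := by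
  constructor
  · intro h u hu
    exact notMem_of_lt_hittingAfter (lt_of_le_of_lt (WithTop.coe_le_coe.2 hu) h) zero_le
  · intro h
    obtain ⟨ε, hε, hX⟩ := C.exists_right_const t ω
    have h1 : ((t + ε : ℝ≥0) : WithTop ℝ≥0) ≤ C.passage D ω := by
      by_contra hlt
      rw [not_le, passage, hittingAfter_lt_iff] at hlt
      obtain ⟨u, hu, hD⟩ := hlt
      rcases le_total u t with hut | htu
      · exact h u hut hD
      · rw [hX u htu hu.2] at hD
        exact h t le_rfl hD
    exact lt_of_lt_of_le (WithTop.coe_lt_coe.2 (lt_add_of_pos_right t hε)) h1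

theorem survives_eq_stays (D : Set S) (t : ℝ≥0) : C.survives D t = C.stays D 0 t := by
  ext ω
  simp only [survives, stays, Set.mem_ofPred_eq, lt_passage_iff, zero_add]

theorem killed_eq_some_iff (D : Set S) (t : ℝ≥0) (ω : Ω) (j : {i : S // i ∉ D}) :
    C.killed D t ω = some j ↔ ω ∈ C.survives D t ∧ C.X t ω = j := by
  unfold killed
  split_ifs with h
  · simp only [Option.some.injEq, Subtype.ext_iff]
    exact ⟨fun h' => ⟨h, h'⟩, fun h' => h'.2⟩
  · simp only [false_iff, not_and]
    exact fun h' => absurd h' h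

theorem killed_eq_none_iff (D : Set S) (t : ℝ≥0) (ω : Ω) :
    C.killed D t ω = none ↔ ω ∉ C.survives D t := by
  unfold killed
  split_ifs with h
  · exact iff_of_false (by simp) (not_not.2 h)
  · exact iff_of_true rfl h

/-- A visit to `D` lasts for some $\varepsilon>0$, so every grid of mesh below $\varepsilon$ detects
it. -/
theorem stays_eq_iInter (D : Set S) (s t : ℝ≥0) :
    C.stays D s t = ⋂ n : ℕ, C.gridStays D s (t / 2 ^ n) (2 ^ n) := by
  ext ω
  simp only [Set.mem_iInter, stays, gridStays, Set.mem_ofPred_eq]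
  constructor
  · intro h n m hm
    refine h _ ?_
    rw [mul_div_assoc', div_le_iff₀ (by positivity), mul_comm]
    gcongr
    exact_mod_cast hm
  · intro h u hu hD
    rcases eq_or_ne t 0 with rfl | ht
    · obtain rfl : u = 0 := le_antisymm hu zero_le
      exact h 0 0 zero_le (by simpa using hD)
    have ht' : 0 < t := pos_iff_ne_zero.2 ht
    obtain ⟨ε, hε, hX⟩ := C.exists_right_const (s + u) ω
    obtain ⟨n, hn⟩ := exists_pow_lt_of_lt_one (div_pos hε ht') (by
      rw [← NNReal.coe_lt_coe]; norm_num : (1 / 2 : ℝ≥0) < 1)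
    have hh : 0 < t / 2 ^ n := by positivity
    have hhe : t / 2 ^ n < ε := by
      rw [lt_div_iff₀ ht', one_div, inv_pow] at hn
      rwa [div_eq_inv_mul]
    set h' := t / 2 ^ n with hh'
    -- The first grid point at or after `u` is less than one mesh away, and does not exceed `t`.
    have hm1 : u ≤ ⌈u / h'⌉₊ * h' := by
      rw [← div_le_iff₀ hh]
      exact Nat.le_ceil _
    have hm2 : ⌈u / h'⌉₊ * h' < u + h' := by
      calc (⌈u / h'⌉₊ : ℝ≥0) * h' < (u / h' + 1) * h' := by
            gcongr
            exact Nat.ceil_lt_add_one zero_le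
        _ = u + h' := by rw [add_mul, one_mul, div_mul_cancel₀ _ hh.ne']
    have hm3 : ⌈u / h'⌉₊ ≤ 2 ^ n := by
      rw [Nat.ceil_le, div_le_iff₀ hh, hh']
      push_cast
      rw [mul_div_cancel₀ _ (by positivity)]
      exact hu
    refine h n _ hm3 ?_
    rw [← hh', hX _ (by gcongr) ?_]
    · exact hD
    · rw [add_assoc]
      gcongr
      exact hm2.trans (by gcongr)

theorem gridStays_antitone (D : Set S) (s t : ℝ≥0) :
    Antitone fun n : ℕ => C.gridStays D s (t / 2 ^ n) (2 ^ n) := by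
  refine antitone_nat_of_succ_le fun n ω hω m hm => ?_
  have := hω (2 * m) (by rw [pow_succ']; gcongr)
  convert this using 3
  push_cast
  field_simp
  ring

theorem measurableSet_past {s u : ℝ≥0} (hu : u ≤ s) (B : Set S) :
    MeasurableSet[C.past s] {ω | C.X u ω ∈ B} := by
  have hle : MeasurableSpace.comap (C.X u) ⊤ ≤ C.past s :=
    le_iSup₂_of_le (f := fun u (_ : u ∈ Set.Iic s) => MeasurableSpace.comap (C.X u) ⊤) u hu le_rfl
  exact hle _ ⟨B, trivial, rfl⟩

theorem measurableSet_past_gridStays (D : Set S) {s h r : ℝ≥0} {n : ℕ} (hr : s + n * h ≤ r) :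
    MeasurableSet[C.past r] (C.gridStays D s h n) := by
  have : C.gridStays D s h n = ⋂ m : ℕ, ⋂ _ : m ≤ n, {ω | C.X (s + m * h) ω ∈ Dᶜ} := by
    ext ω; simp [gridStays]
  rw [this]
  refine MeasurableSet.iInter fun m => MeasurableSet.iInter fun hm =>
    C.measurableSet_past (le_trans ?_ hr) _
  gcongr

theorem measurableSet_past_stays (D : Set S) {s t r : ℝ≥0} (hr : s + t ≤ r) :
    MeasurableSet[C.past r] (C.stays D s t) := by
  rw [stays_eq_iInter]
  refine MeasurableSet.iInter fun n => C.measurableSet_past_gridStays D ?_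
  push_cast
  rwa [mul_div_cancel₀ _ (by positivity)]

theorem start_eq (i : S) (A : Set Ω) : C.P i (A ∩ {ω | C.X 0 ω = i}) = C.P i A := by
  have := C.prob i
  refine measure_inter_conull ?_
  rw [prob_compl_eq_zero_iff (C.measurable_state 0 i)]
  exact C.start i

theorem survives_add (D : Set S) (s t : ℝ≥0) :
    C.survives D (s + t) = C.survives D s ∩ C.stays D s t := by
  ext ω
  simp only [survives_eq_stays, stays, Set.mem_inter_iff, Set.mem_ofPred_eq, zero_add]
  refine ⟨fun h => ⟨fun u hu => h u (hu.trans le_self_add), fun u hu => h _ (by gcongr)⟩,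
    fun h u hu => ?_⟩
  rcases le_total u s with hus | hsu
  · exact h.1 u hus
  · obtain ⟨v, rfl⟩ := exists_add_of_le hsu
    exact h.2 v (le_of_add_le_add_left hu)

variable [Countable S]

theorem measurableSet_X (t : ℝ≥0) (B : Set S) : MeasurableSet {ω | C.X t ω ∈ B} := by
  have : {ω | C.X t ω ∈ B} = ⋃ j ∈ B, {ω | C.X t ω = j} := by ext; simp
  rw [this]
  exact MeasurableSet.biUnion (Set.to_countable B) fun j _ => C.measurable_state t j

theorem past_le (s : ℝ≥0) : C.past s ≤ ‹MeasurableSpace Ω› := by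
  refine iSup₂_le fun u _ => ?_
  rintro _ ⟨B, -, rfl⟩
  exact C.measurableSet_X u B

theorem measurableSet_stays (D : Set S) (s t : ℝ≥0) : MeasurableSet (C.stays D s t) :=
  C.past_le _ _ (C.measurableSet_past_stays D le_rfl)

theorem measurableSet_survives (D : Set S) (t : ℝ≥0) : MeasurableSet (C.survives D t) := by
  rw [survives_eq_stays]
  exact C.measurableSet_stays D 0 t

theorem measurableSet_gridStays (D : Set S) (s h : ℝ≥0) (n : ℕ) :
    MeasurableSet (C.gridStays D s h n) :=
  C.past_le _ _ (C.measurableSet_past_gridStays D le_rfl)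

theorem measure_eq_tsum_state (μ : Measure Ω) {A : Set Ω} (hA : MeasurableSet A) (t : ℝ≥0) :
    μ A = ∑' l, μ (A ∩ {ω | C.X t ω = l}) := by
  rw [← measure_iUnion]
  · congr 1
    ext ω
    simp
  · intro l l' hl
    refine Set.disjoint_left.2 fun ω h h' => hl ?_
    exact h.2.symm.trans h'.2
  · exact fun l => hA.inter (C.measurable_state t l)

open Classical in
/-- The taboo probabilities `ℙ_j(X_0, X_h, …, X_{nh} ∉ D, X_{nh} = k)`. -/
noncomputable def taboo (D : Set S) (h : ℝ≥0) : ℕ → S → S → ℝ≥0∞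
  | 0, j, k => if j = k ∧ k ∉ D then 1 else 0
  | n + 1, j, k => if k ∈ D then 0 else ∑' l, taboo D h n j l * C.P l {ω | C.X h ω = k}

/-- Induction on `n`: split by the state at time $s+nh$ and apply the Markov property there. Only
finitely many times enter, so the plain Markov property suffices; the continuous-time version
follows by refining the grid. -/
theorem measure_inter_gridStays (D : Set S) (i j k : S) (s h : ℝ≥0) (n : ℕ) {A : Set Ω}
    (hA : MeasurableSet[C.past s] A) :
    C.P i (A ∩ {ω | C.X s ω = j} ∩ (C.gridStays D s h n ∩ {ω | C.X (s + n * h) ω = k})) =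
      C.P i (A ∩ {ω | C.X s ω = j}) * C.taboo D h n j k := by
  classical
  induction n generalizing k with
  | zero =>
    simp only [taboo]
    split_ifs with hjk
    · rw [mul_one]
      congr 1
      ext ω
      simp only [gridStays, Set.mem_inter_iff, Set.mem_ofPred_eq, Nat.le_zero]
      refine ⟨fun h => h.1, fun h => ⟨h, ?_, ?_⟩⟩
      · rintro m rfl
        simp [h.2, hjk.1, hjk.2]
      · simp [h.2, hjk.1]
    · rw [mul_zero]
      convert measure_empty (μ := C.P i)
      ext ω
      simp only [gridStays, Set.mem_inter_iff, Set.mem_ofPred_eq, Set.mem_empty_iff_false, iff_false]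
      rintro ⟨⟨-, h1⟩, h2, h3⟩
      have h4 := h2 0 le_rfl
      simp only [Nat.cast_zero, zero_mul, add_zero] at h3 h4
      rw [h3] at h4
      exact hjk ⟨h1.symm.trans h3, h4⟩
  | succ n ih =>
    have hcast : s + ((n + 1 : ℕ) : ℝ≥0) * h = s + n * h + h := by push_cast; ring
    simp only [taboo]
    split_ifs with hk
    · rw [mul_zero]
      convert measure_empty (μ := C.P i)
      ext ω
      simp only [gridStays, Set.mem_inter_iff, Set.mem_ofPred_eq, Set.mem_empty_iff_false, iff_false]
      rintro ⟨-, h2, h3⟩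
      exact h2 (n + 1) le_rfl (h3 ▸ hk)
    · have hset : A ∩ {ω | C.X s ω = j} ∩
          (C.gridStays D s h (n + 1) ∩ {ω | C.X (s + ((n + 1 : ℕ) : ℝ≥0) * h) ω = k}) =
          A ∩ {ω | C.X s ω = j} ∩ C.gridStays D s h n ∩ {ω | C.X (s + n * h + h) ω = k} := by
        rw [hcast]
        ext ω
        simp only [gridStays, Set.mem_inter_iff, Set.mem_ofPred_eq]
        refine ⟨fun h => ⟨⟨h.1, fun m hm => h.2.1 m (hm.trans n.le_succ)⟩, h.2.2⟩,
          fun h => ⟨h.1.1, fun m hm => ?_, h.2⟩⟩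
        rcases Nat.le_succ_iff.1 hm with hm | rfl
        · exact h.1.2 m hm
        · rw [Nat.succ_eq_add_one, hcast, h.2]
          exact hk
      have hsle : s ≤ s + n * h := le_self_add
      have hpast : MeasurableSet[C.past (s + n * h)]
          (A ∩ {ω | C.X s ω = j} ∩ C.gridStays D s h n) := by
        refine MeasurableSet.inter (MeasurableSet.inter ?_ (C.measurableSet_past hsle {j}))
          (C.measurableSet_past_gridStays D le_rfl)
        exact (biSup_mono fun u hu => le_trans (Set.mem_Iic.1 hu) hsle : C.past s ≤ _) _ hA
      rw [hset, C.measure_eq_tsum_state (C.P i)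
        ((C.past_le _ _ hpast).inter (C.measurable_state _ k)) (s + n * h), ← ENNReal.tsum_mul_left]
      refine tsum_congr fun l => ?_
      rw [Set.inter_right_comm, C.markov i (s + n * h) h _ hpast, ← mul_assoc, ← ih, Set.inter_assoc]

theorem taboo_eq (D : Set S) (j k : S) (h : ℝ≥0) (n : ℕ) :
    C.taboo D h n j k = C.P j (C.gridStays D 0 h n ∩ {ω | C.X (n * h) ω = k}) := by
  have := C.measure_inter_gridStays D j j k 0 h n (A := Set.univ) MeasurableSet.univ
  rw [Set.univ_inter, C.start, one_mul, Set.inter_comm, C.start_eq, zero_add] at this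
  exact this.symm

theorem tendsto_gridStays (D : Set S) (i k : S) (s t : ℝ≥0) {A : Set Ω} (hA : MeasurableSet A) :
    Tendsto (fun n : ℕ => C.P i (A ∩ (C.gridStays D s (t / 2 ^ n) (2 ^ n) ∩
      {ω | C.X (s + (2 ^ n : ℕ) * (t / 2 ^ n)) ω = k}))) atTop
      (𝓝 (C.P i (A ∩ (C.stays D s t ∩ {ω | C.X (s + t) ω = k})))) := by
  have := C.prob i
  have hcast : ∀ n : ℕ, ((2 ^ n : ℕ) : ℝ≥0) * (t / 2 ^ n) = t := fun n => by
    push_cast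
    exact mul_div_cancel₀ _ (by positivity)
  simp only [hcast]
  have : A ∩ (C.stays D s t ∩ {ω | C.X (s + t) ω = k}) = ⋂ n : ℕ,
      A ∩ (C.gridStays D s (t / 2 ^ n) (2 ^ n) ∩ {ω | C.X (s + t) ω = k}) := by
    rw [stays_eq_iInter, Set.iInter_inter, Set.inter_iInter]
  rw [this]
  refine tendsto_measure_iInter_atTop (fun n => ?_) (fun m n hmn => ?_)
    ⟨0, measure_ne_top _ _⟩
  · exact (hA.inter ((C.measurableSet_gridStays D _ _ _).inter
      (C.measurable_state _ k))).nullMeasurableSet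
  · exact Set.inter_subset_inter_right _ (Set.inter_subset_inter_left _
      (C.gridStays_antitone D s t hmn))

theorem tendsto_taboo (D : Set S) (j k : S) (t : ℝ≥0) :
    Tendsto (fun n : ℕ => C.taboo D (t / 2 ^ n) (2 ^ n) j k) atTop
      (𝓝 (C.P j (C.survives D t ∩ {ω | C.X t ω = k}))) := by
  have := C.tendsto_gridStays D j k 0 t MeasurableSet.univ
  simp only [Set.univ_inter, zero_add] at this
  simp only [taboo_eq, survives_eq_stays]
  exact this

/-- The Markov property for the killed process. -/
theorem measure_inter_stays (D : Set S) (i j k : S) (s t : ℝ≥0) {A : Set Ω}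
    (hA : MeasurableSet[C.past s] A) :
    C.P i (A ∩ {ω | C.X s ω = j} ∩ (C.stays D s t ∩ {ω | C.X (s + t) ω = k})) =
      C.P i (A ∩ {ω | C.X s ω = j}) * C.P j (C.survives D t ∩ {ω | C.X t ω = k}) := by
  have := C.prob i
  refine tendsto_nhds_unique (C.tendsto_gridStays D i k s t
    ((C.past_le s _ hA).inter (C.measurable_state s j))) ?_
  simp only [C.measure_inter_gridStays D i j k s _ _ hA]
  exact ENNReal.Tendsto.const_mul (C.tendsto_taboo D j k t) (Or.inr (measure_ne_top _ _))

theorem measure_survives_add (D : Set S) (i k : S) (s t : ℝ≥0) :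
    C.P i (C.survives D (s + t) ∩ {ω | C.X (s + t) ω = k}) =
      ∑' j, C.P i (C.survives D s ∩ {ω | C.X s ω = j}) *
        C.P j (C.survives D t ∩ {ω | C.X t ω = k}) := by
  have hm : MeasurableSet[C.past s] (C.survives D s) := by
    rw [survives_eq_stays]
    exact C.measurableSet_past_stays D (zero_add s).le
  rw [C.measure_eq_tsum_state (C.P i) ((C.measurableSet_survives D _).inter
    (C.measurable_state _ k)) s]
  refine tsum_congr fun j => ?_
  rw [← C.measure_inter_stays D i j k s t hm, survives_add]
  congr 1
  ext ω
  simp only [Set.mem_inter_iff]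
  tauto

end CTMarkovChain

/-! ### Lower bounds for the rates of the killed chain -/

namespace CTMarkovChain

variable {S Ω : Type*} [MeasurableSpace Ω] (C : CTMarkovChain S Ω)

/-- Keep only the grid paths that sit at `i` at every step. -/
theorem pow_le_taboo (D : Set S) {i : S} (hi : i ∉ D) (h : ℝ≥0) (n : ℕ) :
    C.P i {ω | C.X h ω = i} ^ n ≤ C.taboo D h n i i := by
  induction n with
  | zero => simp [taboo, hi]
  | succ n ih =>
    simp only [taboo, hi, if_false, pow_succ]
    exact le_trans (by gcongr) (ENNReal.le_tsum i)

/-- Keep only the grid paths that sit at `i`, move once to `j` and remain there: `n` choices of the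
moving step, the other $n-1$ steps having probability at least `c` each. The exponent `n` in place
of $n-1$ is a harmless loss. -/
theorem mul_pow_le_taboo (D : Set S) {i j : S} (hij : i ≠ j) (hi : i ∉ D) (hj : j ∉ D)
    (h : ℝ≥0) (n : ℕ) {c : ℝ≥0∞} (hc : c ≤ C.P i {ω | C.X h ω = i})
    (hc' : c ≤ C.P j {ω | C.X h ω = j}) :
    n * (C.P i {ω | C.X h ω = j} * c ^ n) ≤ C.taboo D h n i j := by
  classical
  have := C.prob i
  have hc1 : c ≤ 1 := hc.trans prob_le_one
  induction n with
  | zero => simp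
  | succ n ih =>
    simp only [taboo, hj, if_false]
    calc ((n + 1 : ℕ) : ℝ≥0∞) * (C.P i {ω | C.X h ω = j} * c ^ (n + 1))
        = n * (C.P i {ω | C.X h ω = j} * c ^ n) * c
          + c ^ (n + 1) * C.P i {ω | C.X h ω = j} := by
          push_cast; ring
      _ ≤ C.taboo D h n i j * C.P j {ω | C.X h ω = j}
          + C.taboo D h n i i * C.P i {ω | C.X h ω = j} := by
          gcongr
          calc c ^ (n + 1) ≤ c ^ n := pow_le_pow_right_of_le_one' hc1 n.le_succ
            _ ≤ C.P i {ω | C.X h ω = i} ^ n := by gcongr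
            _ ≤ _ := C.pow_le_taboo D hi h n
      _ ≤ _ := by
          rw [add_comm, ← Finset.sum_pair hij
            (f := fun l => C.taboo D h n i l * C.P l {ω | C.X h ω = j})]
          exact ENNReal.sum_le_tsum _

theorem trans_nonneg (t : ℝ) (i j : S) : 0 ≤ C.trans t i j := measureReal_nonneg

theorem trans_le_one (t : ℝ) (i j : S) : C.trans t i j ≤ 1 := by
  have := C.prob i
  exact measureReal_le_one

theorem trans_zero_self (i : S) : C.trans 0 i i = 1 := by
  simp [trans, measureReal_def, C.start i]

theorem trans_zero_of_ne {i j : S} (hij : i ≠ j) : C.trans 0 i j = 0 := by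
  have h := C.start_eq i {ω | C.X 0 ω = j}
  have : {ω | C.X 0 ω = j} ∩ {ω | C.X 0 ω = i} = ∅ := by
    ext ω
    simp only [Set.mem_inter_iff, Set.mem_ofPred_eq, Set.mem_empty_iff_false, iff_false]
    exact fun h => hij (h.2.symm.trans h.1)
  rw [this, measure_empty] at h
  simp [trans, measureReal_def, ← h]

theorem killedTrans_some_some (D : Set S) (t : ℝ) (i j : {i : S // i ∉ D}) :
    C.killedTrans D t (some i) (some j) =
      (C.P i).real (C.survives D t.toNNReal ∩ {ω | C.X t.toNNReal ω = j}) := by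
  simp only [killedTrans]
  congr 1
  ext ω
  exact C.killed_eq_some_iff D _ ω j

theorem killedTrans_some_none (D : Set S) (t : ℝ) (i : {i : S // i ∉ D}) :
    C.killedTrans D t (some i) none = (C.P i).real (C.survives D t.toNNReal)ᶜ := by
  simp only [killedTrans]
  congr 1
  ext ω
  exact C.killed_eq_none_iff D _ ω

theorem measure_survives_inter_of_mem {D : Set S} (μ : Measure Ω) (t : ℝ≥0) {k : S} (hk : k ∈ D) :
    μ (C.survives D t ∩ {ω | C.X t ω = k}) = 0 := by
  convert measure_empty (μ := μ)
  ext ω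
  simp only [survives, lt_passage_iff, Set.mem_inter_iff, Set.mem_ofPred_eq,
    Set.mem_empty_iff_false, iff_false]
  rintro ⟨h1, h2⟩
  exact h1 t le_rfl (h2 ▸ hk)

theorem killedTrans_nonneg (D : Set S) (t : ℝ) (i j : EDelta D) : 0 ≤ C.killedTrans D t i j := by
  cases i with
  | none => simp only [killedTrans]; split_ifs <;> norm_num
  | some i => exact measureReal_nonneg

variable {C} {Q : S → S → ℝ}

theorem HasQMatrix.tendsto_div (hQ : C.HasQMatrix Q) {i j : S} (hij : i ≠ j) :
    Tendsto (fun h => C.trans h i j / h) (𝓝[>] 0) (𝓝 (Q i j)) := by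
  have h := (hQ i j).mono Set.Ioi_subset_Ici_self
  rw [hasDerivWithinAt_iff_tendsto_slope' (by simp)] at h
  refine h.congr fun t => ?_
  rw [slope_def_field, C.trans_zero_of_ne hij, sub_zero, sub_zero]

theorem HasQMatrix.tendsto_div_self (hQ : C.HasQMatrix Q) (i : S) :
    Tendsto (fun h => (1 - C.trans h i i) / h) (𝓝[>] 0) (𝓝 (-Q i i)) := by
  have h := (hQ i i).mono Set.Ioi_subset_Ici_self
  rw [hasDerivWithinAt_iff_tendsto_slope' (by simp)] at h
  refine h.neg.congr fun t => ?_
  rw [slope_def_field, C.trans_zero_self, sub_zero, ← neg_div, neg_sub]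

theorem HasQMatrix.nonneg (hQ : C.HasQMatrix Q) {i j : S} (hij : i ≠ j) : 0 ≤ Q i j := by
  refine ge_of_tendsto (hQ.tendsto_div hij) ?_
  filter_upwards [self_mem_nhdsWithin] with h hh
  exact div_nonneg (C.trans_nonneg h i j) (le_of_lt hh)

theorem tendsto_two_pow_mul {f : ℝ → ℝ} {a t : ℝ} (ht : 0 < t)
    (hf : Tendsto (fun h => f h / h) (𝓝[>] 0) (𝓝 a)) :
    Tendsto (fun n : ℕ => (2 : ℝ) ^ n * f (t / 2 ^ n)) atTop (𝓝 (a * t)) := by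
  have h0 : Tendsto (fun n : ℕ => t / 2 ^ n) atTop (𝓝[>] 0) := by
    refine tendsto_nhdsWithin_iff.2 ⟨?_, Eventually.of_forall fun n => ?_⟩
    · exact tendsto_const_nhds.div_atTop (tendsto_pow_atTop_atTop_of_one_lt one_lt_two)
    · exact Set.mem_Ioi.2 (by positivity)
  refine ((hf.comp h0).mul_const t).congr fun n => ?_
  simp only [Function.comp]
  field_simp

variable [Countable S]

/-- Bernoulli's inequality with $N=2^n$ and $h=t/N$: $p_{ii}(h)^N\ge 1+N(p_{ii}(h)-1)\to 1+q_{ii}t$.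
-/
theorem HasQMatrix.diag_le (hQ : C.HasQMatrix Q) (D : Set S) {i : S} (hi : i ∉ D) {t : ℝ}
    (ht : 0 ≤ t) :
    1 + Q i i * t ≤ (C.P i).real (C.survives D t.toNNReal ∩ {ω | C.X t.toNNReal ω = i}) := by
  have := C.prob i
  rcases ht.eq_or_lt with rfl | ht
  · have hs : C.survives D 0 ∩ {ω | C.X 0 ω = i} = {ω | C.X 0 ω = i} := by
      ext ω
      simp only [survives_eq_stays, stays, Set.mem_inter_iff, Set.mem_ofPred_eq, and_iff_right_iff_imp]
      rintro h u hu
      obtain rfl : u = 0 := le_antisymm hu zero_le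
      simpa [h] using hi
    simp [hs, measureReal_def, C.start]
  have h1 := (ENNReal.tendsto_toReal (measure_ne_top (C.P i) _)).comp
    (C.tendsto_taboo D i i t.toNNReal)
  have h2 := (tendsto_two_pow_mul ht (hQ.tendsto_div_self i)).const_sub 1
  rw [neg_mul, sub_neg_eq_add] at h2
  refine le_of_tendsto_of_tendsto' h2 h1 fun n => ?_
  have h3 := ENNReal.toReal_mono (by
    rw [taboo_eq]; exact measure_ne_top _ _) (C.pow_le_taboo D hi (t.toNNReal / 2 ^ n) (2 ^ n))
  rw [ENNReal.toReal_pow] at h3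
  refine le_trans ?_ h3
  have h4 : t.toNNReal / 2 ^ n = (t / 2 ^ n).toNNReal := by
    rw [Real.toNNReal_div ht.le, Real.toNNReal_pow (by norm_num), Real.toNNReal_ofNat]
  have h5 := one_add_mul_le_pow (a := C.trans (t / 2 ^ n) i i - 1)
    (by linarith [C.trans_nonneg (t / 2 ^ n) i i]) (2 ^ n)
  rw [h4]
  rw [add_sub_cancel] at h5
  refine le_trans ?_ h5
  push_cast
  linarith

/-- The one-move bound with $N=2^n$ and $h=t/N$: $Np_{ij}(h)\to q_{ij}t$, while Bernoulli bounds
$c^N$ below by a quantity tending to $1+(q_{ii}+q_{jj})t$. -/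
theorem HasQMatrix.offdiag_le (hQ : C.HasQMatrix Q) (D : Set S) {i j : S} (hij : i ≠ j)
    (hi : i ∉ D) (hj : j ∉ D) {t : ℝ} (ht : 0 < t) :
    Q i j * t * (1 + (Q i i + Q j j) * t) ≤
      (C.P i).real (C.survives D t.toNNReal ∩ {ω | C.X t.toNNReal ω = j}) := by
  have := C.prob i
  have := C.prob j
  have h1 := (ENNReal.tendsto_toReal (measure_ne_top (C.P i) _)).comp
    (C.tendsto_taboo D i j t.toNNReal)
  have h2 := (tendsto_two_pow_mul ht (hQ.tendsto_div hij)).mul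
    (((tendsto_two_pow_mul ht (hQ.tendsto_div_self i)).add
      (tendsto_two_pow_mul ht (hQ.tendsto_div_self j))).const_sub 1)
  rw [show 1 - (-Q i i * t + -Q j j * t) = 1 + (Q i i + Q j j) * t by ring] at h2
  refine le_of_tendsto_of_tendsto' h2 h1 fun n => ?_
  have h4 : t.toNNReal / 2 ^ n = (t / 2 ^ n).toNNReal := by
    rw [Real.toNNReal_div ht.le, Real.toNNReal_pow (by norm_num), Real.toNNReal_ofNat]
  simp only [Function.comp, h4]
  set h := t / 2 ^ n
  set c := min (C.P i {ω | C.X h.toNNReal ω = i}) (C.P j {ω | C.X h.toNNReal ω = j}) with hc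
  have h3 := ENNReal.toReal_mono (by
    rw [taboo_eq]; exact measure_ne_top _ _) (C.mul_pow_le_taboo D hij hi hj h.toNNReal (2 ^ n)
      (c := c) (min_le_left _ _) (min_le_right _ _))
  have hcr : c.toReal = min (C.trans h i i) (C.trans h j j) := by
    rw [hc, ENNReal.toReal_min (measure_ne_top _ _) (measure_ne_top _ _)]
    rfl
  -- The minimum of two numbers that are at most 1 is at least their sum minus 1.
  have hcb : C.trans h i i + C.trans h j j - 1 ≤ c.toReal := by
    rw [hcr, le_min_iff]
    constructor <;> linarith [C.trans_le_one h i i, C.trans_le_one h j j]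
  have h5 := one_add_mul_le_pow (a := c.toReal - 1)
    (by linarith [c.toReal_nonneg]) (2 ^ n)
  rw [add_sub_cancel] at h5
  rw [ENNReal.toReal_mul, ENNReal.toReal_mul, ENNReal.toReal_pow, ENNReal.toReal_natCast] at h3
  refine le_trans ?_ h3
  rw [← mul_assoc]
  push_cast at h5 ⊢
  refine mul_le_mul_of_nonneg_left (le_trans ?_ h5)
    (mul_nonneg (by positivity) (C.trans_nonneg h i j))
  have h2n : (0 : ℝ) ≤ 2 ^ n := by positivity
  nlinarith [mul_le_mul_of_nonneg_left hcb h2n]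

variable (C)

theorem measurableSet_killed (D : Set S) (t : ℝ≥0) (j : EDelta D) :
    MeasurableSet {ω | C.killed D t ω = j} := by
  cases j with
  | none =>
    simp only [killed_eq_none_iff]
    exact (C.measurableSet_survives D t).compl
  | some j =>
    simp only [killed_eq_some_iff]
    exact (C.measurableSet_survives D t).inter (C.measurable_state t j)

theorem hasSum_killed (D : Set S) (μ : Measure Ω) [IsProbabilityMeasure μ] (t : ℝ≥0) :
    HasSum (fun j : EDelta D => μ.real {ω | C.killed D t ω = j}) 1 := by
  have h : ∑' j : EDelta D, μ {ω | C.killed D t ω = j} = 1 := by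
    rw [← measure_iUnion, ← measure_univ (μ := μ)]
    · congr 1
      ext ω
      simp
    · intro l l' hl
      exact Set.disjoint_left.2 fun ω h h' => hl (h.symm.trans h')
    · exact fun l => C.measurableSet_killed D t l
  have hs := ENNReal.hasSum_toReal (f := fun j : EDelta D => μ {ω | C.killed D t ω = j})
    (by rw [h]; exact ENNReal.one_ne_top)
  rw [← ENNReal.tsum_toReal_eq (fun _ => measure_ne_top _ _), h, ENNReal.toReal_one] at hs
  exact hs

theorem killedTrans_add_some (D : Set S) {s t : ℝ} (hs : 0 ≤ s) (ht : 0 ≤ t)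
    (i k : {i : S // i ∉ D}) :
    C.killedTrans D (s + t) (some i) (some k) =
      ∑' l, C.killedTrans D s (some i) l * C.killedTrans D t l (some k) := by
  have hP := C.prob
  have hinj : Function.Injective (fun j : {i : S // i ∉ D} => (some j : EDelta D)) :=
    Option.some_injective _
  rw [← hinj.tsum_eq, killedTrans_some_some, measureReal_def, Real.toNNReal_add hs ht,
    measure_survives_add, ENNReal.tsum_toReal_eq, ← Subtype.val_injective.tsum_eq]
  · refine tsum_congr fun j => ?_
    rw [ENNReal.toReal_mul, killedTrans_some_some, killedTrans_some_some]
    rfl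
  · intro j hj
    by_contra hD
    rw [Subtype.range_coe_subtype] at hD
    have hjD : j ∈ D := by simpa using hD
    exact hj (by simp [C.measure_survives_inter_of_mem (C.P i) _ hjD])
  · exact fun j => ENNReal.mul_ne_top (measure_ne_top _ _) (measure_ne_top _ _)
  · rintro (_ | j) hj
    · exact absurd (by simp [killedTrans]) hj
    · exact ⟨j, rfl⟩

theorem hasSum_killedTrans (D : Set S) (t : ℝ) (i : EDelta D) :
    HasSum (C.killedTrans D t i) 1 := by
  cases i with
  | none => exact hasSum_ite_eq none 1
  | some i =>
    have := C.prob i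
    exact C.hasSum_killed D (C.P i) t.toNNReal

end CTMarkovChain

/-! ### Row vectors, stochastic matrices and sums over `Option` -/

theorem summable_prod_mul {ι : Type*} {v : ι → ℝ} {A : ι → ι → ℝ} (hv : ∀ i, 0 ≤ v i)
    (hvs : Summable v) (hA : ∀ i j, 0 ≤ A i j) (hAs : ∀ i, HasSum (A i) 1) :
    Summable fun x : ι × ι => v x.1 * A x.1 x.2 := by
  have h0 : ∀ x : ι × ι, 0 ≤ v x.1 * A x.1 x.2 := fun x => mul_nonneg (hv x.1) (hA x.1 x.2)
  refine (summable_prod_of_nonneg h0).2 ⟨fun i => ?_, ?_⟩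
  · exact (hAs i).summable.mul_left (v i)
  · simpa only [tsum_mul_left, (hAs _).tsum_eq, mul_one] using hvs

/-- The product of a nonnegative vector and a stochastic matrix has the mass of the vector. -/
theorem hasSum_rowMul {ι : Type*} {v : ι → ℝ} {A : ι → ι → ℝ} {c : ℝ} (hv : ∀ i, 0 ≤ v i)
    (hvs : HasSum v c) (hA : ∀ i j, 0 ≤ A i j) (hAs : ∀ i, HasSum (A i) 1) :
    HasSum (fun j => ∑' i, v i * A i j) c := by
  have hrow : ∀ i, ∑' j, v i * A i j = v i := fun i => by
    rw [tsum_mul_left, (hAs i).tsum_eq, mul_one]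
  have hs := summable_prod_mul hv hvs.summable hA hAs
  have hc : ∑' j, ∑' i, v i * A i j = c := by
    rw [Summable.tsum_comm (f := fun i j => v i * A i j) hs]
    simp only [hrow]
    exact hvs.tsum_eq
  have h2 : Summable fun j => ∑' i, v i * A i j := hs.prod_symm.prod
  exact hc ▸ h2.hasSum

theorem hasSum_option {ι : Type*} {f : Option ι → ℝ} {c : ℝ} (hf : HasSum (fun i => f (some i)) c) :
    HasSum f (f none + c) := by
  classical
  have h1 : HasSum (fun x => Option.elim x 0 fun i => f (some i)) c := by
    refine ((Option.some_injective ι).hasSum_iff ?_).1 hf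
    rintro (_ | i) hx
    · rfl
    · exact absurd ⟨i, rfl⟩ hx
  convert (hasSum_ite_eq none (f none)).add h1 using 2 with x
  cases x <;> simp

theorem tsum_option_eq {ι : Type*} {f : Option ι → ℝ} {c : ℝ} (hf : HasSum f c) :
    c = f none + ∑' i, f (some i) :=
  hf.unique (hasSum_option (hf.summable.comp_injective (Option.some_injective ι)).hasSum)

/-! ### The killed chain as a transition function with lower rate $Q^T$ -/

namespace CTMarkovChain

variable {S Ω : Type*} [MeasurableSpace Ω] [Countable S] (C : CTMarkovChain S Ω) {Q : S → S → ℝ}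

theorem isTransitionFunction_killedTrans (D : Set S) : IsTransitionFunction (C.killedTrans D) where
  nonneg := C.killedTrans_nonneg D
  hasSum_one := C.hasSum_killedTrans D
  zero_self i := by
    cases i with
    | none => simp [killedTrans]
    | some i =>
      have hs : C.survives D 0 ∩ {ω | C.X 0 ω = i} = {ω | C.X 0 ω = i} := by
        ext ω
        simp only [survives_eq_stays, stays, Set.mem_inter_iff, Set.mem_ofPred_eq,
          and_iff_right_iff_imp]
        rintro h u hu
        obtain rfl : u = 0 := le_antisymm hu zero_le
        simpa [h] using i.2
      rw [killedTrans_some_some, Real.toNNReal_zero, hs]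
      simp [measureReal_def, C.start]
  add s t hs ht i j := by
    cases i with
    | none =>
      rw [tsum_eq_single none fun l hl => by simp [killedTrans, hl]]
      simp [killedTrans]
    | some i =>
      cases j with
      | some j => exact C.killedTrans_add_some D hs ht i j
      | none =>
        -- The column of $\Delta$ follows from the others, since both rows have mass one.
        have h1 := tsum_option_eq (C.hasSum_killedTrans D (s + t) (some i))
        have h2 := tsum_option_eq (hasSum_rowMul (C.killedTrans_nonneg D s (some i))
          (C.hasSum_killedTrans D s (some i)) (C.killedTrans_nonneg D t) (C.hasSum_killedTrans D t))
        simp only [C.killedTrans_add_some D hs ht] at h1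
        linarith
  of_nonpos t ht := by
    ext i j
    cases i with
    | none => rfl
    | some i => simp only [killedTrans, Real.toNNReal_of_nonpos ht, Real.toNNReal_zero]

theorem isLowerRate_killedQ (hQ : C.HasQMatrix Q) (hcons : IsConservative Q) (D : Set S) :
    IsLowerRate (C.killedTrans D) (killedQ Q D) where
  hasSum_zero i := by
    cases i with
    | none => exact hasSum_zero
    | some i =>
      have h1 : Summable fun j : {j // j ∉ D} => Q i j := (hcons i).summable.subtype _
      have h2 : Summable fun j : D => Q i j := (hcons i).summable.subtype _
      have h3 : HasSum (fun j : {j // j ∉ D} => killedQ Q D (some i) (some j))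
        (∑' j : {j // j ∉ D}, Q i j) := h1.hasSum
      have h4 := hasSum_option h3
      have h5 : killedQ Q D (some i) none + ∑' j : {j // j ∉ D}, Q i j = 0 := by
        rw [← (hcons i).tsum_eq]
        exact h2.tsum_add_tsum_compl h1
      rwa [h5] at h4
  offdiag_nonneg i k hik := by
    match i, k with
    | none, _ => exact le_rfl
    | some i, some k => exact hQ.nonneg fun h => hik (congrArg some (Subtype.ext h))
    | some i, none => exact tsum_nonneg fun d => hQ.nonneg fun h => i.2 (h ▸ d.2)
  diag_le i t ht := by
    cases i with
    | none => simp [killedQ, killedTrans]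
    | some i =>
      rw [killedTrans_some_some]
      exact hQ.diag_le D i.2 ht
  offdiag_le i k hik ε hε := by
    match i, k with
    | none, k =>
      filter_upwards [self_mem_nhdsWithin] with h hh
      have := div_nonneg (C.killedTrans_nonneg D h none k) (le_of_lt hh)
      simp only [killedQ]
      linarith
    | some i, some k =>
      have hlim : Tendsto (fun h : ℝ => Q i k * (1 + (Q i i + Q k k) * h)) (𝓝[>] 0)
          (𝓝 (Q i k * (1 + (Q i i + Q k k) * 0))) :=
        ((Continuous.tendsto (by fun_prop) 0).mono_left nhdsWithin_le_nhds)
      rw [mul_zero, add_zero, mul_one] at hlim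
      filter_upwards [self_mem_nhdsWithin, hlim.eventually_const_lt (sub_lt_self _ hε)] with h hh hl
      rw [le_div_iff₀ hh, killedTrans_some_some]
      refine le_trans ?_ (hQ.offdiag_le D (fun h => hik (congrArg some (Subtype.ext h))) i.2 k.2 hh)
      rw [mul_right_comm]
      exact mul_le_mul_of_nonneg_right hl.le (le_of_lt hh)
    | some i, none =>
      have hsum : HasSum (fun d : D => Q i d) (∑' d : D, Q i d) :=
        ((hcons i).summable.subtype _).hasSum
      -- Finitely many states of `D` carry the killing rate up to `ε`; being in one of them at time
      -- `h` forces $T\le h$.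
      obtain ⟨F, hF⟩ := (hsum.eventually_const_lt (sub_lt_self _ hε)).exists
      have hlim : Tendsto (fun h => ∑ d ∈ F, C.trans h i d / h) (𝓝[>] 0) (𝓝 (∑ d ∈ F, Q i d)) :=
        tendsto_finsetSum _ fun d _ => hQ.tendsto_div fun h => i.2 (h ▸ d.2)
      filter_upwards [self_mem_nhdsWithin, hlim.eventually_const_lt hF] with h hh hl
      refine hl.le.trans ?_
      have := C.prob i
      rw [← Finset.sum_div]
      refine div_le_div_of_nonneg_right ?_ (le_of_lt hh)
      rw [killedTrans_some_none]
      simp only [trans]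
      rw [← measureReal_biUnion_finset]
      · refine measureReal_mono fun ω hω => ?_
        simp only [Set.mem_iUnion] at hω
        obtain ⟨d, -, hd⟩ := hω
        simp only [survives_eq_stays, stays, Set.mem_compl_iff, Set.mem_ofPred_eq, zero_add]
        intro hs
        exact hs _ le_rfl (hd ▸ d.2)
      · intro d _ d' _ hd
        exact Set.disjoint_left.2 fun ω h h' => hd (Subtype.ext (h.symm.trans h'))
      · exact fun d _ => C.measurable_state _ _

end CTMarkovChain

/-! ### Integrating a derivative, and the one-sided bound that permits it -/

/-- Integration of `(e^{α t} (v t - c))'`; its integrability follows from a one-sided bound of the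
derivative of `v`. -/
theorem hasImproperIntegral_of_hasDerivAt {v d f : ℝ → ℝ} {α κ c l : ℝ} (hv : Continuous v)
    (hd : ∀ t, 0 < t → HasDerivAt v (d t) t) (hκ : ∀ t, 0 < t → κ * v t ≤ d t)
    (hf : ∀ t, 0 < t → f t = Real.exp (α * t) * (d t + α * (v t - c)))
    (hl : Tendsto (fun t => Real.exp (α * t) * (v t - c)) atTop (𝓝 l)) :
    HasImproperIntegral f (l - (v 0 - c)) := by
  have hexp : ∀ a t : ℝ, HasDerivAt (fun t => Real.exp (a * t)) (Real.exp (a * t) * a) t := by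
    intro a t
    simpa using ((hasDerivAt_id t).const_mul a).exp
  have hint : ∀ R : ℝ, 0 ≤ R → IntervalIntegrable f volume 0 R := by
    intro R hR
    -- This is the derivative of $e^{-\kappa t}v(t)$. It is nonnegative, hence integrable; `f` is a
    -- continuous multiple of it plus a continuous function.
    have h1 : IntervalIntegrable (fun t => Real.exp (-κ * t) * (d t - κ * v t)) volume 0 R := by
      refine intervalIntegral.intervalIntegrable_deriv_of_nonneg
        (g := fun t => Real.exp (-κ * t) * v t) (by fun_prop) (fun t ht => ?_) fun t ht => ?_
      · rw [min_eq_left hR] at ht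
        exact ((hexp (-κ) t).fun_mul (hd t ht.1)).congr_deriv (by ring)
      · rw [min_eq_left hR] at ht
        exact mul_nonneg (Real.exp_pos _).le (sub_nonneg.2 (hκ t ht.1))
    have h2 := (h1.continuousOn_mul (g := fun t => Real.exp ((α + κ) * t)) (by fun_prop)).add
      (Continuous.intervalIntegrable
        (u := fun t => Real.exp (α * t) * (κ * v t + α * (v t - c))) (by fun_prop) 0 R)
    refine h2.congr fun t ht => ?_
    rw [Set.uIoc_of_le hR] at ht
    simp only [hf t ht.1]
    rw [← mul_assoc, ← Real.exp_add, show (α + κ) * t + -κ * t = α * t by ring]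
    ring
  refine ⟨hint, ?_⟩
  refine (hl.sub_const (v 0 - c)).congr' ?_
  filter_upwards [eventually_ge_atTop 0] with R hR
  rw [intervalIntegral.integral_eq_sub_of_hasDerivAt_of_le
    (f := fun t => Real.exp (α * t) * (v t - c)) hR (by fun_prop) (fun t ht => ?_) (hint R hR)]
  · simp
  · refine ((hexp α t).fun_mul ((hd t ht.1).sub_const c)).congr_deriv ?_
    rw [hf t ht.1]
    ring

namespace IsTransitionFunction

variable {ι : Type*} {p : ℝ → ι → ι → ℝ} {q : ι → ι → ℝ} {v : ι → ℝ}

/-- The diagonal entry of `p 0` already has the whole mass of its row, so `p 0` is the identity. -/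
theorem rowMul_zero (hp : IsTransitionFunction p) (j : ι) : rowMul v (p 0) j = v j := by
  have hne : ∀ i, i ≠ j → p 0 i j = 0 := by
    classical
    intro i hij
    have h1 := (hp.hasSum_one 0 i).sub (hasSum_ite_eq i (1 : ℝ))
    rw [sub_self, hasSum_zero_iff_of_nonneg] at h1
    · simpa [hij.symm] using congrFun h1 j
    · intro k
      by_cases hk : k = i
      · subst hk; simp [hp.zero_self]
      · simpa [hk] using hp.nonneg 0 i k
  rw [rowMul, tsum_eq_single j fun i hi => by rw [hne i hi, mul_zero], hp.zero_self, mul_one]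

theorem rowMul_nonneg (hp : IsTransitionFunction p) (hv : ∀ i, 0 ≤ v i) (t : ℝ) (j : ι) :
    0 ≤ rowMul v (p t) j :=
  tsum_nonneg fun i => mul_nonneg (hv i) (hp.nonneg t i j)

theorem hasSum_rowMul (hp : IsTransitionFunction p) (hv : ∀ i, 0 ≤ v i) (hvs : HasSum v 1) (t : ℝ) :
    HasSum (rowMul v (p t)) 1 :=
  _root_.hasSum_rowMul hv hvs (hp.nonneg t) (hp.hasSum_one t)

theorem continuous_rowMul (hp : IsTransitionFunction p) (hq : IsLowerRate p q) (hvs : Summable v)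
    (j : ι) : Continuous fun t => rowMul v (p t) j := by
  refine continuous_tsum (u := fun k => |v k|) (fun k => (hp.continuous hq k j).const_mul _)
    hvs.abs fun k t => ?_
  rw [Real.norm_eq_abs, abs_mul]
  exact mul_le_of_le_one_right (abs_nonneg _) (hp.abs_le_one t k j)

theorem rowMul_add (hp : IsTransitionFunction p) (hv : ∀ i, 0 ≤ v i) (hvs : HasSum v 1) {s t : ℝ}
    (hs : 0 ≤ s) (ht : 0 ≤ t) (j : ι) :
    rowMul v (p (s + t)) j = ∑' k, rowMul v (p s) k * p t k j := by
  have h1 : Summable fun x : ι × ι => v x.1 * p s x.1 x.2 * p t x.2 j := by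
    refine (summable_prod_mul hv hvs.summable (hp.nonneg s) (hp.hasSum_one s)).of_nonneg_of_le
      (fun x => ?_) (fun x => ?_)
    · exact mul_nonneg (mul_nonneg (hv _) (hp.nonneg _ _ _)) (hp.nonneg _ _ _)
    · exact mul_le_of_le_one_right (mul_nonneg (hv _) (hp.nonneg _ _ _)) (hp.le_one _ _ _)
  simp only [rowMul, hp.add s t hs ht, ← tsum_mul_left, ← tsum_mul_right, ← mul_assoc]
  exact (Summable.tsum_comm (f := fun i k => v i * p s i k * p t k j) h1).symm

/-- For $s>t$, $v_j(s)\ge v_j(t)p_{jj}(s-t)\ge v_j(t)(1+q_{jj}(s-t))$, with $v_j(t)$ the `j`-th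
coordinate of the row at time $t$. -/
theorem diag_mul_rowMul_le (hp : IsTransitionFunction p) (hq : IsLowerRate p q)
    (hv : ∀ i, 0 ≤ v i) (hvs : HasSum v 1) {t d : ℝ} (ht : 0 ≤ t) {j : ι}
    (hd : HasDerivAt (fun s => rowMul v (p s) j) d t) : q j j * rowMul v (p t) j ≤ d := by
  have h := hd.hasDerivWithinAt (s := Set.Ioi t)
  rw [hasDerivWithinAt_iff_tendsto_slope' (by simp)] at h
  refine ge_of_tendsto h ?_
  filter_upwards [self_mem_nhdsWithin] with s hs
  have hs' : 0 < s - t := sub_pos.2 hs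
  rw [slope_def_field, le_div_iff₀ hs']
  have h1 : rowMul v (p t) j * p (s - t) j j ≤ rowMul v (p s) j := by
    have := hp.rowMul_add hv hvs ht hs'.le j
    rw [add_sub_cancel] at this
    rw [this]
    exact ((hp.summable_mul (hp.hasSum_rowMul hv hvs t).summable _ j)).le_tsum j
      fun k _ => mul_nonneg (hp.rowMul_nonneg hv t k) (hp.nonneg _ _ _)
  have h2 := mul_le_mul_of_nonneg_left (hq.diag_le j _ hs'.le) (hp.rowMul_nonneg hv t j)
  nlinarith

end IsTransitionFunction

/-! ### Conditional laws and quasi-stationarity of the Yaglom limit -/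

namespace CTMarkovChain

variable {S Ω : Type*} [MeasurableSpace Ω] (C : CTMarkovChain S Ω) {D : Set S} {ν : EDelta D → ℝ}

theorem isProbabilityMeasure_law (hν : IsDistribution ν) : IsProbabilityMeasure (C.law ν) := by
  have hP := C.prob
  have h1 : HasSum (fun i => ν (some i)) 1 := by
    have h2 := (hν.hasSum.summable.comp_injective (Option.some_injective _)).hasSum
    have h3 := tsum_option_eq hν.hasSum
    rw [hν.cemetery, zero_add] at h3
    rwa [h3]
  constructor
  simp only [law, Measure.sum_apply _ MeasurableSet.univ, Measure.smul_apply, measure_univ,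
    smul_eq_mul, mul_one]
  rw [← ENNReal.ofReal_tsum_of_nonneg (fun i => hν.nonneg _) h1.summable, h1.tsum_eq,
    ENNReal.ofReal_one]

theorem killedTrans_none_eq (t : ℝ) (j : EDelta D) : C.killedTrans D t none j = deltaVec D j := by
  cases j <;> simp [killedTrans, deltaVec]

variable [Countable S]

theorem law_real_killed (hν : IsDistribution ν) (t : ℝ) (j : EDelta D) :
    (C.law ν).real {ω | C.killed D t.toNNReal ω = j} = rowMul ν (C.killedTrans D t) j := by
  have hP := C.prob
  have hs := tsum_option_eq
    ((C.isTransitionFunction_killedTrans D).summable_mul hν.hasSum.summable t j).hasSum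
  rw [hν.cemetery, zero_mul, zero_add] at hs
  rw [rowMul, hs, measureReal_def, law, Measure.sum_apply _ (C.measurableSet_killed D _ j),
    ENNReal.tsum_toReal_eq]
  · refine tsum_congr fun i => ?_
    rw [Measure.smul_apply, smul_eq_mul, ENNReal.toReal_mul, ENNReal.toReal_ofReal (hν.nonneg _)]
    rfl
  · intro i
    rw [Measure.smul_apply, smul_eq_mul]
    exact ENNReal.mul_ne_top ENNReal.ofReal_ne_top (measure_ne_top _ _)

theorem law_real_survives (hν : IsDistribution ν) (t : ℝ) :
    (C.law ν).real (C.survives D t.toNNReal) = 1 - rowMul ν (C.killedTrans D t) none := by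
  have := C.isProbabilityMeasure_law hν
  rw [← C.law_real_killed hν]
  simp only [killed_eq_none_iff]
  have := probReal_compl_eq_one_sub (μ := C.law ν) (C.measurableSet_survives D t.toNNReal)
  rw [show {ω | ω ∉ C.survives D t.toNNReal} = (C.survives D t.toNNReal)ᶜ from rfl]
  linarith

theorem condLaw_none (t : ℝ≥0) : C.condLaw ν t none = 0 := by
  rw [condLaw, measureReal_def, ProbabilityTheory.cond_apply (C.measurableSet_survives D t)]
  have : C.survives D t ∩ {ω | C.killed D t ω = none} = ∅ := by
    simp only [killed_eq_none_iff]
    exact Set.inter_compl_self _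
  rw [this]
  simp

theorem condLaw_some (hν : IsDistribution ν) (t : ℝ≥0) (j : {i : S // i ∉ D}) :
    C.condLaw ν t (some j) =
      ((C.law ν).real (C.survives D t))⁻¹ * rowMul ν (C.killedTrans D t) (some j) := by
  rw [condLaw, measureReal_def, ProbabilityTheory.cond_apply (C.measurableSet_survives D t),
    ENNReal.toReal_mul, ENNReal.toReal_inv, ← C.law_real_killed hν, Real.toNNReal_coe]
  have : C.survives D t ∩ {ω | C.killed D t ω = some j} = {ω | C.killed D t ω = some j} := by
    simp only [killed_eq_some_iff]
    ext ω
    simp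
  rw [this]
  rfl

theorem hasSum_condLaw (hν : IsDistribution ν) (t : ℝ≥0)
    (h : (C.law ν).real (C.survives D t) ≠ 0) : HasSum (C.condLaw ν t) 1 := by
  have := C.isProbabilityMeasure_law hν
  have : IsProbabilityMeasure (ProbabilityTheory.cond (C.law ν) (C.survives D t)) :=
    ProbabilityTheory.cond_isProbabilityMeasure fun h0 => h (by rw [measureReal_def, h0]; rfl)
  exact C.hasSum_killed D _ t

/-- On $E$ the conditional law is $e^{\alpha t}\mu P^T(t)$. Applying $P^T(s)$ turns it into
$e^{-\alpha s}$ times the conditional law at time $t+s$; as $t\to\infty$ this gives $\pi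
P^T(s)=e^{-\alpha s}\pi$ on $E$. -/
theorem isQuasiStationary_of_isQuasiLimiting {μ π : EDelta D → ℝ} {α : ℝ} (hμ : IsDistribution μ)
    (hexp : C.IsExponential μ α) (hπ : C.IsQuasiLimiting μ π) : C.IsQuasiStationary π := by
  have hp := C.isTransitionFunction_killedTrans D
  have hcond : ∀ (t : ℝ≥0) (j : {i : S // i ∉ D}), C.condLaw μ t (some j) =
      Real.exp (α * t) * rowMul μ (C.killedTrans D t) (some j) := fun t j => by
    rw [C.condLaw_some hμ, hexp t, ← Real.exp_neg, neg_mul, neg_neg]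
  have hinv : ∀ (s : ℝ≥0) (j : {i : S // i ∉ D}),
      rowMul π (C.killedTrans D s) (some j) = Real.exp (-α * s) * π (some j) := by
    intro s j
    have h1 : Tendsto (fun t : ℝ≥0 => ∑' k, C.condLaw μ t k * C.killedTrans D s k (some j)) atTop
        (𝓝 (∑' k, π k * C.killedTrans D s k (some j))) := by
      refine tendsto_tsum_mul_of_lower_limit hπ.1.hasSum (Eventually.of_forall fun t => ?_)
        (Eventually.of_forall fun t k => ?_) (fun k => ?_) (fun k => hp.abs_le_one s k (some j))
      · exact C.hasSum_condLaw hμ t (by rw [hexp t]; exact (Real.exp_pos _).ne')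
      · rw [abs_of_nonneg (hπ.1.nonneg k)]
        exact max_le (sub_le_self _ measureReal_nonneg) (hπ.1.nonneg k)
      · have h := (((hπ.2 k).const_sub (π k)).sup_nhds (tendsto_const_nhds (x := (0 : ℝ))))
        rwa [sub_self, sup_idem] at h
    have h2 : Tendsto (fun t : ℝ≥0 => t + s) atTop atTop :=
      tendsto_atTop_mono (fun _ => le_self_add) tendsto_id
    refine tendsto_nhds_unique h1 (((hπ.2 (some j)).comp h2).const_mul _ |>.congr fun t => ?_)
    -- At $k=\Delta$ both sides vanish, because $\Delta$ never leads to $E$.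
    have h3 : ∀ k, C.condLaw μ t k * C.killedTrans D s k (some j) = Real.exp (α * t) *
        (rowMul μ (C.killedTrans D t) k * C.killedTrans D s k (some j)) := by
      rintro (_ | k)
      · simp [killedTrans]
      · rw [hcond, mul_assoc]
    simp only [h3, Function.comp]
    rw [tsum_mul_left, ← hp.rowMul_add hμ.nonneg hμ.hasSum t.coe_nonneg s.coe_nonneg, hcond,
      ← mul_assoc, ← Real.exp_add]
    push_cast
    congr 2
    ring
  refine ⟨hπ.1, fun t i => ?_⟩
  -- Sum the eigenvector relation over $E$, where `π` has mass one.
  have hsurv : (C.law π).real (C.survives D t) = Real.exp (-α * t) := by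
    have h1 := C.law_real_survives hπ.1 (t : ℝ)
    have h2 := tsum_option_eq (hp.hasSum_rowMul hπ.1.nonneg hπ.1.hasSum t)
    have h3 := tsum_option_eq hπ.1.hasSum
    rw [hπ.1.cemetery, zero_add] at h3
    simp only [hinv, tsum_mul_left, ← h3] at h2
    rw [Real.toNNReal_coe] at h1
    linarith
  cases i with
  | none => rw [C.condLaw_none, hπ.1.cemetery]
  | some j =>
    rw [C.condLaw_some hπ.1, hsurv, hinv, inv_mul_cancel_left₀ (Real.exp_pos _).ne']

end CTMarkovChain

/-! ### The integral formula -/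

theorem mainTheorem6 {S Ω : Type*} [Countable S] [MeasurableSpace Ω]
    (C : CTMarkovChain S Ω) (Q : S → S → ℝ) (hQ : C.HasQMatrix Q) (hcons : IsConservative Q)
    (hirr : C.Irreducible) (D : Set S) (μ π : EDelta D → ℝ) (hμ : IsDistribution μ)
    (α : ℝ) (hα : 0 < α) (hexp : C.IsExponential μ α) (hdiff : C.DiffCondition μ)
    (hπ : C.IsQuasiLimiting μ π) :
    -- all series in the integrand converge absolutely
    (∀ t : ℝ, 0 < t → ∀ j : EDelta D,
      (∀ i, Summable fun k => killedQ Q D i k * C.killedTrans D t k j) ∧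
      (Summable fun i => μ i * infMatMul (killedQ Q D) (C.killedTrans D t) i j) ∧
      (Summable fun i => (α • (μ - deltaVec D)) i * C.killedTrans D t i j)) ∧
    -- the order of the summations does not matter where the double series converges absolutely
    (∀ t : ℝ, 0 < t → ∀ j : EDelta D,
      (Summable fun p : EDelta D × EDelta D =>
        μ p.1 * |killedQ Q D p.1 p.2| * C.killedTrans D t p.2 j) →
      C.correction Q μ α t j = Real.exp (α * t) *
        rowMul (rowMul μ (killedQ Q D) + α • (μ - deltaVec D)) (C.killedTrans D t) j) ∧
    -- the integral formula
    (∃ L : EDelta D → ℝ,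
      (∀ j, HasImproperIntegral (fun t => C.correction Q μ α t j) (L j)) ∧ π = μ + L) ∧
    C.IsQuasiStationary π := by
  have hp := C.isTransitionFunction_killedTrans D
  have hq := C.isLowerRate_killedQ hQ hcons D
  have hback : ∀ t : ℝ, 0 < t → ∀ i j, deriv (fun s => C.killedTrans D s i j) t =
      infMatMul (killedQ Q D) (C.killedTrans D t) i j :=
    fun t ht i j => (hp.hasDerivAt hq i j ht).deriv
  have hδ : HasSum (deltaVec D) 1 := by
    convert C.hasSum_killedTrans D 0 none using 1
    ext j
    rw [C.killedTrans_none_eq]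
  have hgen : ∀ t : ℝ, 0 < t → ∀ j,
      Summable (fun i => μ i * infMatMul (killedQ Q D) (C.killedTrans D t) i j) ∧
      HasDerivAt (fun s => rowMul μ (C.killedTrans D s) j)
        (rowMul μ (infMatMul (killedQ Q D) (C.killedTrans D t)) j) t := by
    intro t ht j
    have h := hdiff t ht j
    simp only [hback t ht] at h
    exact h
  have hαs : ∀ t j, Summable fun i => (α • (μ - deltaVec D)) i * C.killedTrans D t i j :=
    fun t j => hp.summable_mul ((hμ.hasSum.summable.sub hδ.summable).const_smul α) t j
  refine ⟨fun t ht j => ⟨fun i => hp.summable_mul (hq.hasSum_zero i).summable t j,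
    (hgen t ht j).1, hαs t j⟩, fun t ht j hs => ?_, ⟨π - μ, fun j => ?_, by simp⟩,
    C.isQuasiStationary_of_isQuasiLimiting hμ hexp hπ⟩
  -- Fubini for the absolutely convergent double series.
  · have hs' : Summable fun x : EDelta D × EDelta D =>
        μ x.1 * killedQ Q D x.1 x.2 * C.killedTrans D t x.2 j := by
      refine hs.of_norm_bounded fun x => le_of_eq ?_
      rw [Real.norm_eq_abs, abs_mul, abs_mul, abs_of_nonneg (hμ.nonneg _),
        abs_of_nonneg (hp.nonneg _ _ _)]
    have h1 : Summable fun k => rowMul μ (killedQ Q D) k * C.killedTrans D t k j := by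
      have h2 : Summable fun k => ∑' i, μ i * killedQ Q D i k * C.killedTrans D t k j :=
        hs'.prod_symm.prod
      simp only [tsum_mul_right] at h2
      exact h2
    rw [CTMarkovChain.correction]
    congr 1
    have h2 : rowMul (rowMul μ (killedQ Q D) + α • (μ - deltaVec D)) (C.killedTrans D t) j =
        ∑' k, rowMul μ (killedQ Q D) k * C.killedTrans D t k j +
          rowMul (α • (μ - deltaVec D)) (C.killedTrans D t) j := by
      refine Eq.trans (tsum_congr fun k => ?_) (h1.tsum_add (hαs t j))
      rw [Pi.add_apply, add_mul]
    rw [h2]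
    congr 1
    simp only [rowMul, infMatMul, ← tsum_mul_left, ← tsum_mul_right, ← mul_assoc]
    exact (Summable.tsum_comm
      (f := fun i k => μ i * killedQ Q D i k * C.killedTrans D t k j) hs').symm
  · have hcorr : ∀ t : ℝ, 0 < t → C.correction Q μ α t j = Real.exp (α * t) *
        (rowMul μ (infMatMul (killedQ Q D) (C.killedTrans D t)) j +
          α * (rowMul μ (C.killedTrans D t) j - deltaVec D j)) := by
      intro t ht
      rw [CTMarkovChain.correction]
      congr 2
      have h1 := hp.summable_mul hμ.hasSum.summable t j
      have h2 := hp.summable_mul hδ.summable t j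
      have h3 : rowMul (deltaVec D) (C.killedTrans D t) j = deltaVec D j := by
        rw [rowMul, tsum_eq_single none, C.killedTrans_none_eq]
        · simp [deltaVec]
        · rintro (_ | i) hi
          · exact absurd rfl hi
          · simp [deltaVec]
      conv_rhs => rw [← h3, rowMul, rowMul, ← h1.tsum_sub h2, ← tsum_mul_left]
      refine tsum_congr fun i => ?_
      simp only [Pi.smul_apply, Pi.sub_apply, smul_eq_mul]
      ring
    have hlim : Tendsto (fun t : ℝ => Real.exp (α * t) *
        (rowMul μ (C.killedTrans D t) j - deltaVec D j)) atTop (𝓝 (π j - deltaVec D j)) := by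
      have hle : ∀ᶠ t : ℝ in atTop, C.condLaw μ t.toNNReal j - deltaVec D j =
          Real.exp (α * t) * (rowMul μ (C.killedTrans D t) j - deltaVec D j) := by
        filter_upwards [eventually_ge_atTop 0] with t ht
        have hsurv := hexp t.toNNReal
        have h1 := C.law_real_survives hμ t
        rw [Real.coe_toNNReal t ht] at hsurv
        cases j with
        | none =>
          rw [C.condLaw_none]
          have h2 : rowMul μ (C.killedTrans D t) none - 1 = -Real.exp (-α * t) := by linarith
          simp only [deltaVec]
          rw [h2, mul_neg, ← Real.exp_add, neg_mul, add_neg_cancel, Real.exp_zero, zero_sub]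
        | some j =>
          rw [C.condLaw_some hμ, Real.coe_toNNReal t ht, hsurv, ← Real.exp_neg, neg_mul, neg_neg]
          simp [deltaVec]
      exact (((hπ.2 j).comp tendsto_real_toNNReal_atTop).sub_const _).congr' hle
    have := hasImproperIntegral_of_hasDerivAt (hp.continuous_rowMul hq hμ.hasSum.summable j)
      (fun t ht => (hgen t ht j).2)
      (fun t ht => hp.diag_mul_rowMul_le hq hμ.nonneg hμ.hasSum ht.le (hgen t ht j).2) hcorr hlim
    -- The two copies of $\delta_j$, from the limit and from $t=0$, cancel.
    rw [hp.rowMul_zero, sub_sub_sub_cancel_right] at this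
    exact this
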